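/- Let $(\Omega,\mathcal F,\mathbb P)$ be a probability space with a filtration $\mathcal F_{-1}\subseteq\mathcal F_0\subseteq\mathcal F_1\subseteq\cdots$, and consider the system $x_{k+1}=A_{\mathrm{tr}}x_k+B_{\mathrm{tr}}u_k+w_k$, $x_0=0$, with $x_k,w_k\in\mathbb R^{n_{\mathrm x}}$, $u_k\in\mathbb R^{n_{\mathrm u}}$. Put $n_\phi=n_{\mathrm x}+n_{\mathrm u}$, $\phi_k=[x_k^\top,u_k^\top]^\top$ and $\theta_{\mathrm{tr}}=\mathrm{vec}([A_{\mathrm{tr}},B_{\mathrm{tr}}])\in\mathbb R^{n_\phi n_{\mathrm x}}$, where $\mathrm{vec}$ stacks columns. Suppose that for every $k\ge 0$, $\phi_k$ is $\mathcal F_{k-1}$-measurable and $w_k$ is $\mathcal F_k$-measurable, and that $w_k$ has mean zero and is conditionally sub-Gaussian with proxy variance $\sigma_{\mathrm w}^2I_{n_{\mathrm x}}$: $$\mathbb E\big[\exp(\ell^\top w_k)\,\big|\,\mathcal F_{k-1}\big]\le\exp\big(\sigma_{\mathrm w}^2\|\ell\|^2/2\big)\ \text{ almost surely, for all }\ell\in\mathbb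 R^{n_{\mathrm x}}.$$ Suppose that for some $D_0\succ0$ and some vector $\hat\theta_0$, $$(\hat\theta_0-\theta_{\mathrm{tr}})^\top(D_0\otimes I_{n_{\mathrm x}})(\hat\theta_0-\theta_{\mathrm{tr}})\le1,$$ and let $\bar\theta=\|\hat\theta_0\|+\|D_0^{-1/2}\|$ (Euclidean and spectral norm). Let $D_{\mathrm{des}}\succ0$, $\lambda>0$, $T\in\mathbb N$ and $\delta>0$ (for $\delta\ge1$ the assertion is void). Let $\Phi=[\phi_0,\dots,\phi_{T-1}]$, $X=[x_1^\top,\dots,x_T^\top]^\top$, $$\bar D_T=(\Phi\Phi^\top)\otimes I_{n_{\mathrm x}}+\lambda I_{n_\phi n_{\mathrm x}},\qquad \hat\theta_T=\bar D_T^{-1}(\Phi\otimes I_{n_{\mathrm x}})X,$$ $$R(\bar D_T)=8\sigma_{\mathrm w}^2\log\left(\frac{5^{n_{\mathrm x}}\det(\bar D_T)^{1/2}}{\delta\,\det(\lambda I_{n_{\mathrm x}n_\phi})^{1/2}}\right).$$ Consider the condition on the data $$\Phi\Phi^\top+\lambda I_{n_\phi}-\big(R(\bar D_T)^{1/2}+\lambda^{1/2}\bar\theta\big)^2D_{\mathrm{des}}\succeq0\qquad(\ast)$$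 and the exploration goal $$(\theta_{\mathrm{tr}}-\hat\theta_T)^\top(D_{\mathrm{des}}\otimes I_{n_{\mathrm x}})(\theta_{\mathrm{tr}}-\hat\theta_T)\le1.\qquad(\ast\ast)$$ Then, with probability at least $1-\delta$, the implication $(\ast)\Rightarrow(\ast\ast)$ holds for the realized data. In particular, if $\Phi$ satisfies $(\ast)$ almost surely, then $\hat\theta_T$ satisfies $(\ast\ast)$ with probability at least $1-\delta$. -/

import Mathlib

open MeasureTheory
open scoped Kronecker Matrix

noncomputable section

namespace TargetedExploration

/-- The random vector `w`, with mean `m`, is conditionally sub-Gaussian with proxy variance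
`S ⪰ 0` given the sub-σ-algebra `F`: for every `l`, `E[exp (lᵀ (w - m)) | F] ≤ exp (lᵀ S l / 2)`
almost surely.  Integrability of the exponentials (part of the meaning of the bound) is explicit,
because Mathlib's conditional expectation of a non-integrable function is `0`. -/
structure IsCondSubGaussian {Ω : Type*} {mΩ : MeasurableSpace Ω} {n : ℕ}
    (P : Measure Ω) (F : MeasurableSpace Ω) (w : Ω → Fin n → ℝ) (m : Fin n → ℝ)
    (S : Matrix (Fin n) (Fin n) ℝ) : Prop where
  posSemidef : S.PosSemidef
  integrable : Integrable w P
  mean_eq : ∫ ω, w ω ∂P = m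
  integrable_exp : ∀ l : Fin n → ℝ, Integrable (fun ω => Real.exp (l ⬝ᵥ (w ω - m))) P
  condExp_le : ∀ l : Fin n → ℝ,
    P[fun ω => Real.exp (l ⬝ᵥ (w ω - m)) | F] ≤ᵐ[P] fun _ => Real.exp ((l ⬝ᵥ S *ᵥ l) / 2)

/-- The index set of the regressor `φ = (x, u)`; it has `nx + nu` elements. -/
abbrev RegIdx (nx nu : ℕ) : Type := Fin nx ⊕ Fin nu

/-- The index set of the parameter `θ = vec [A, B]` (column index first, row index second),
as in Mathlib's `Matrix.vec`; it has `(nx + nu) * nx` elements. -/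
abbrev ParIdx (nx nu : ℕ) : Type := RegIdx nx nu × Fin nx

/-- `θ = vec [A, B]`. -/
def paramVec {nx nu : ℕ} (A : Matrix (Fin nx) (Fin nx) ℝ) (B : Matrix (Fin nx) (Fin nu) ℝ) :
    ParIdx nx nu → ℝ :=
  (Matrix.fromCols A B).vec

/-- The regressor `φ_k = (x_k, u_k)`. -/
def regressor {nx nu : ℕ} (x : ℕ → Fin nx → ℝ) (u : ℕ → Fin nu → ℝ) (k : ℕ) :
    RegIdx nx nu → ℝ :=
  Sum.elim (x k) (u k)

/-- `Φ = [φ_0, …, φ_{T-1}]`. -/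
def dataMatrix {nx nu : ℕ} (T : ℕ) (x : ℕ → Fin nx → ℝ) (u : ℕ → Fin nu → ℝ) :
    Matrix (RegIdx nx nu) (Fin T) ℝ :=
  Matrix.of fun i k => regressor x u k i

/-- The stacked vector `X = (x_1, …, x_T)`; its entry `(k, i)` is the `i`-th entry of `x_{k+1}`. -/
def stackedStates {nx : ℕ} (T : ℕ) (x : ℕ → Fin nx → ℝ) : Fin T × Fin nx → ℝ :=
  fun p => x (p.1 + 1) p.2

/-- `(Φ Φᵀ) ⊗ I + lam I`. -/
def regExcitation {nx nu T : ℕ} (lam : ℝ) (Φ : Matrix (RegIdx nx nu) (Fin T) ℝ) :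
    Matrix (ParIdx nx nu) (ParIdx nx nu) ℝ :=
  (Φ * Φᵀ) ⊗ₖ (1 : Matrix (Fin nx) (Fin nx) ℝ) + lam • 1

/-- The regularized least-squares estimate `((Φ Φᵀ) ⊗ I + lam I)⁻¹ (Φ ⊗ I) X` of `vec [A, B]`
from the data up to time `T`. -/
def rlsEstimate {nx nu : ℕ} (lam : ℝ) (T : ℕ) (x : ℕ → Fin nx → ℝ) (u : ℕ → Fin nu → ℝ) :
    ParIdx nx nu → ℝ :=
  (regExcitation lam (dataMatrix T x u))⁻¹ *ᵥ
    ((dataMatrix T x u ⊗ₖ (1 : Matrix (Fin nx) (Fin nx) ℝ)) *ᵥ stackedStates T x)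

/-- The radius `R(D) = 8 σ² log (5 ^ nx * det(D)^{1/2} / (δ * det(lam I)^{1/2}))`. -/
def radius {nx nu : ℕ} (σ lam δ : ℝ) (D : Matrix (ParIdx nx nu) (ParIdx nx nu) ℝ) : ℝ :=
  8 * σ ^ 2 * Real.log ((5 : ℝ) ^ nx * √D.det /
    (δ * √(lam • (1 : Matrix (ParIdx nx nu) (ParIdx nx nu) ℝ)).det))

open scoped MatrixOrder Matrix.Norms.L2Operator in
/-- `‖D^{-1/2}‖`, the spectral norm of the inverse of the positive square root of `D ≻ 0`. -/
def normInvSqrt {ι : Type*} [Fintype ι] [DecidableEq ι] (D : Matrix ι ι ℝ) : ℝ :=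
  ‖(CFC.sqrt D)⁻¹‖

/-- The bound `‖θ₀‖ + ‖D₀^{-1/2}‖` on the Euclidean norm of the true parameter. -/
def thetaBar {nx nu : ℕ} (θ₀ : ParIdx nx nu → ℝ)
    (D₀ : Matrix (RegIdx nx nu) (RegIdx nx nu) ℝ) : ℝ :=
  ‖WithLp.toLp 2 θ₀‖ + normInvSqrt D₀

/-- The quadratic form `vᵀ (D ⊗ I) v`. -/
def kronForm {nx nu : ℕ} (D : Matrix (RegIdx nx nu) (RegIdx nx nu) ℝ)
    (v : ParIdx nx nu → ℝ) : ℝ :=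
  v ⬝ᵥ ((D ⊗ₖ (1 : Matrix (Fin nx) (Fin nx) ℝ)) *ᵥ v)

/-- The prior ellipsoid `{θ : (θ₀ - θ)ᵀ (D₀ ⊗ I) (θ₀ - θ) ≤ 1}`. -/
def priorSet {nx nu : ℕ} (θ₀ : ParIdx nx nu → ℝ)
    (D₀ : Matrix (RegIdx nx nu) (RegIdx nx nu) ℝ) : Set (ParIdx nx nu → ℝ) :=
  {θ | kronForm D₀ (θ₀ - θ) ≤ 1}

/-- The condition on the data matrix,
`Φ Φᵀ + lam I - (R(D)^{1/2} + lam^{1/2} θbar)² Ddes ⪰ 0` with `D = (Φ Φᵀ) ⊗ I + lam I`. -/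
def DataCondition {nx nu T : ℕ} (σ lam δ θbar : ℝ)
    (Ddes : Matrix (RegIdx nx nu) (RegIdx nx nu) ℝ)
    (Φ : Matrix (RegIdx nx nu) (Fin T) ℝ) : Prop :=
  (Φ * Φᵀ + lam • (1 : Matrix (RegIdx nx nu) (RegIdx nx nu) ℝ) -
    (√(radius σ lam δ (regExcitation lam Φ)) + √lam * θbar) ^ 2 • Ddes).PosSemidef

end TargetedExploration

end

/-! Put `K = Φ ⊗ I` and `D = K Kᵀ + lam I`. The stacked states are `X = Kᵀ θ + W` with `W` the
stacked noise, so the estimation error is `D⁻¹ (lam θ) - D⁻¹ K W`. In the norm of `D`, the first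
term is at most `√lam ‖θ‖ ≤ √lam θbar`, by the prior ellipsoid, and the second is the
self-normalized noise `‖K W‖` in the norm of `D⁻¹` (`sqrt_rls_error_le`).

The noise is controlled by the method of mixtures. For fixed `ψ`, the exponential of `ψᵀ K W - σ²
‖Kᵀ ψ‖² / 2` has mean at most `1` by successive conditioning (`lintegral_prod_tiltedExp_le_one`).
Integrating over `ψ` against a Gaussian weight of precision `σ² lam` completes the square and
produces `D⁻¹` and `det D`; Markov's inequality then gives `measure_lt_selfNormalized_le`. The
threshold depends on the realized `D`, so no union bound is needed, and it lies below `R(D)`.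

On this noise event the rest is deterministic: `(∗)` says that `D` dominates `(√R + √lam θbar)²
(Ddes ⊗ I)`, which turns the error bound into the goal (`kronForm_le_one_of_dataCondition`). -/

namespace TargetedExploration

open scoped ENNReal Topology

/-! ### Conditional sub-Gaussian bounds in a random, past-measurable direction. -/

/-- A measurable function with values in `ℝⁿ` is a pointwise limit of measurable functions with
finite range. -/
lemma exists_finite_range_tendsto {Ω : Type*} [MeasurableSpace Ω] {n : ℕ} {L : Ω → Fin n → ℝ}
    (hL : Measurable L) : ∃ f : ℕ → Ω → Fin n → ℝ, (∀ k, Measurable (f k)) ∧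
      (∀ k, (Set.range (f k)).Finite) ∧
      ∀ ω, Filter.Tendsto (fun k => f k ω) Filter.atTop (𝓝 (L ω)) :=
  have hLs := hL.stronglyMeasurable
  ⟨fun k => hLs.approx k, fun k => (hLs.approx k).measurable,
    fun k => (hLs.approx k).finite_range, hLs.tendsto_approx⟩

section CondSubGaussian

variable {Ω : Type*} {F mΩ : MeasurableSpace Ω} {P : Measure Ω} [IsProbabilityMeasure P]
  {n : ℕ} {w : Ω → Fin n → ℝ} {σ : ℝ}

/-- The exponential `exp (lᵀ w - σ² ‖l‖² / 2)`, whose conditional mean is at most `1` if `w` is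
conditionally sub-Gaussian. -/
noncomputable def tiltedExp (σ : ℝ) (l w : Fin n → ℝ) : ℝ≥0∞ :=
  ENNReal.ofReal (Real.exp (l ⬝ᵥ w - σ ^ 2 / 2 * (l ⬝ᵥ l)))

lemma continuous_tiltedExp (v : Fin n → ℝ) : Continuous fun l => tiltedExp σ l v := by
  simp only [tiltedExp, dotProduct]
  exact ENNReal.continuous_ofReal.comp (by fun_prop)

lemma measurable_tiltedExp {α : Type*} {mα : MeasurableSpace α} {f g : α → Fin n → ℝ}
    (hf : Measurable f) (hg : Measurable g) : Measurable fun a => tiltedExp σ (f a) (g a) := by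
  simp only [tiltedExp, dotProduct]
  fun_prop

lemma IsCondSubGaussian.setLIntegral_tiltedExp_le (hF : F ≤ mΩ)
    (h : IsCondSubGaussian P F w 0 (σ ^ 2 • (1 : Matrix (Fin n) (Fin n) ℝ)))
    (l : Fin n → ℝ) {s : Set Ω} (hs : MeasurableSet[F] s) :
    ∫⁻ ω in s, tiltedExp σ l (w ω) ∂P ≤ P s := by
  have hint : Integrable (fun ω => Real.exp (l ⬝ᵥ w ω)) P := by simpa using h.integrable_exp l
  have hce : P[fun ω => Real.exp (l ⬝ᵥ w ω) | F]
      ≤ᵐ[P] fun _ => Real.exp (σ ^ 2 / 2 * (l ⬝ᵥ l)) := by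
    convert h.condExp_le l using 2
    · simp
    · simp [Matrix.smul_mulVec]; ring_nf
  have h1 : ∫ ω in s, Real.exp (l ⬝ᵥ w ω) ∂P ≤ Real.exp (σ ^ 2 / 2 * (l ⬝ᵥ l)) * P.real s := by
    rw [← setIntegral_condExp hF hint hs]
    refine (setIntegral_mono_ae integrable_condExp.integrableOn
      (integrable_const _).integrableOn hce).trans (le_of_eq ?_)
    simp [mul_comm]
  have h2 : ∫ ω in s, Real.exp (l ⬝ᵥ w ω - σ ^ 2 / 2 * (l ⬝ᵥ l)) ∂P ≤ P.real s := by
    simp only [Real.exp_sub]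
    rw [integral_div, div_le_iff₀ (Real.exp_pos _), mul_comm]
    exact h1
  have h3 : Integrable (fun ω => Real.exp (l ⬝ᵥ w ω - σ ^ 2 / 2 * (l ⬝ᵥ l))) P := by
    simp only [Real.exp_sub]
    exact hint.div_const _
  unfold tiltedExp
  rw [← ofReal_integral_eq_lintegral_ofReal h3.integrableOn
    (ae_of_all _ fun _ => (Real.exp_pos _).le)]
  refine (ENNReal.ofReal_le_ofReal h2).trans ?_
  rw [ofReal_measureReal]

/-- Reweighting `P` by the tilted exponential gives a measure that is dominated by `P` on `F`, so
integrals of `F`-measurable nonnegative functions cannot grow; no integrability of `Z` is needed. -/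
lemma IsCondSubGaussian.lintegral_mul_tiltedExp_le_of_const (hF : F ≤ mΩ) (hw : Measurable w)
    (h : IsCondSubGaussian P F w 0 (σ ^ 2 • (1 : Matrix (Fin n) (Fin n) ℝ)))
    (l : Fin n → ℝ) {Z : Ω → ℝ≥0∞} (hZ : Measurable[F] Z) :
    ∫⁻ ω, Z ω * tiltedExp σ l (w ω) ∂P ≤ ∫⁻ ω, Z ω ∂P := by
  have hm : Measurable fun ω => tiltedExp σ l (w ω) := measurable_tiltedExp measurable_const hw
  have hle : (P.withDensity fun ω => tiltedExp σ l (w ω)).trim hF ≤ P.trim hF := by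
    refine Measure.le_iff.2 fun s hs => ?_
    rw [trim_measurableSet_eq hF hs, trim_measurableSet_eq hF hs, withDensity_apply _ (hF s hs)]
    exact h.setLIntegral_tiltedExp_le hF l hs
  calc ∫⁻ ω, Z ω * tiltedExp σ l (w ω) ∂P
      = ∫⁻ ω, Z ω ∂(P.withDensity fun ω => tiltedExp σ l (w ω)) := by
        rw [lintegral_withDensity_eq_lintegral_mul _ hm (hZ.mono hF le_rfl)]
        simp [mul_comm]
    _ = ∫⁻ ω, Z ω ∂(P.withDensity fun ω => tiltedExp σ l (w ω)).trim hF :=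
        (lintegral_trim hF hZ).symm
    _ ≤ ∫⁻ ω, Z ω ∂P.trim hF := lintegral_mono' hle le_rfl
    _ = ∫⁻ ω, Z ω ∂P := lintegral_trim hF hZ

/-- On each fibre of `f` the direction is constant, and the indicator of the fibre is absorbed into
`Z`. -/
lemma IsCondSubGaussian.lintegral_mul_tiltedExp_le_of_finite_range (hF : F ≤ mΩ)
    (hw : Measurable w)
    (h : IsCondSubGaussian P F w 0 (σ ^ 2 • (1 : Matrix (Fin n) (Fin n) ℝ)))
    {f : Ω → Fin n → ℝ} (hf : ∀ y, MeasurableSet[F] (f ⁻¹' {y})) (hfin : (Set.range f).Finite)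
    {Z : Ω → ℝ≥0∞} (hZ : Measurable[F] Z) :
    ∫⁻ ω, Z ω * tiltedExp σ (f ω) (w ω) ∂P ≤ ∫⁻ ω, Z ω ∂P := by
  classical
  have hsplit (g : (Fin n → ℝ) → Ω → ℝ≥0∞) (ω : Ω) :
      Z ω * g (f ω) ω = ∑ y ∈ hfin.toFinset, (f ⁻¹' {y}).indicator Z ω * g y ω := by
    rw [Finset.sum_eq_single (f ω)]
    · simp [Set.indicator]
    · intro y _ hy
      simp [Set.indicator, hy.symm]
    · intro hn
      exact absurd (by simp) hn
  have hZi (y : Fin n → ℝ) : Measurable[F] ((f ⁻¹' {y}).indicator Z) := hZ.indicator (hf y)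
  calc ∫⁻ ω, Z ω * tiltedExp σ (f ω) (w ω) ∂P
      = ∑ y ∈ hfin.toFinset, ∫⁻ ω, (f ⁻¹' {y}).indicator Z ω * tiltedExp σ y (w ω) ∂P := by
        simp_rw [hsplit fun y ω => tiltedExp σ y (w ω)]
        exact lintegral_finsetSum _ fun y _ =>
          ((hZi y).mono hF le_rfl).mul (measurable_tiltedExp measurable_const hw)
    _ ≤ ∑ y ∈ hfin.toFinset, ∫⁻ ω, (f ⁻¹' {y}).indicator Z ω ∂P :=
        Finset.sum_le_sum fun y _ => h.lintegral_mul_tiltedExp_le_of_const hF hw y (hZi y)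
    _ = ∫⁻ ω, Z ω ∂P := by
        rw [← lintegral_finsetSum _ fun y _ => (hZi y).mono hF le_rfl]
        refine lintegral_congr fun ω => ?_
        simpa using (hsplit (fun _ _ => 1) ω).symm

/-- The sub-Gaussian bound holds almost surely for each fixed direction, with a null set depending
on it. Finite-range approximation and Fatou's lemma pass to a random direction. -/
lemma IsCondSubGaussian.lintegral_mul_tiltedExp_le (hF : F ≤ mΩ) (hw : Measurable w)
    (h : IsCondSubGaussian P F w 0 (σ ^ 2 • (1 : Matrix (Fin n) (Fin n) ℝ)))
    {L : Ω → Fin n → ℝ} (hL : Measurable[F] L) {Z : Ω → ℝ≥0∞} (hZ : Measurable[F] Z) :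
    ∫⁻ ω, Z ω * tiltedExp σ (L ω) (w ω) ∂P ≤ ∫⁻ ω, Z ω ∂P := by
  obtain ⟨f, hf, hfin, hlim⟩ : ∃ f : ℕ → Ω → Fin n → ℝ, (∀ k, Measurable[F] (f k)) ∧
      (∀ k, (Set.range (f k)).Finite) ∧
      ∀ ω, Filter.Tendsto (fun k => f k ω) Filter.atTop (𝓝 (L ω)) := by
    exact @exists_finite_range_tendsto _ F _ _ hL
  have hmeas (k : ℕ) : Measurable fun ω => Z ω * tiltedExp σ (f k ω) (w ω) :=
    (hZ.mono hF le_rfl).mul (measurable_tiltedExp ((hf k).mono hF le_rfl) hw)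
  calc ∫⁻ ω, Z ω * tiltedExp σ (L ω) (w ω) ∂P
      = ∫⁻ ω, Filter.liminf (fun k => Z ω * tiltedExp σ (f k ω) (w ω)) Filter.atTop ∂P := by
        refine lintegral_congr fun ω => (Filter.Tendsto.liminf_eq ?_).symm
        have ht : Filter.Tendsto (fun k => tiltedExp σ (f k ω) (w ω)) Filter.atTop
            (𝓝 (tiltedExp σ (L ω) (w ω))) :=
          ((continuous_tiltedExp (w ω)).tendsto (L ω)).comp (hlim ω)
        -- `Z` may be infinite, so convergence of the product rests on the limit being nonzero.
        refine ENNReal.Tendsto.const_mul ht (Or.inl ?_)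
        simp [tiltedExp, Real.exp_pos]
    _ ≤ Filter.liminf (fun k => ∫⁻ ω, Z ω * tiltedExp σ (f k ω) (w ω) ∂P) Filter.atTop :=
        lintegral_liminf_le hmeas
    _ ≤ ∫⁻ ω, Z ω ∂P :=
        Filter.liminf_le_of_frequently_le' (Filter.Frequently.of_forall fun k =>
          h.lintegral_mul_tiltedExp_le_of_finite_range hF hw
            (fun y => hf k (measurableSet_singleton y)) (hfin k) hZ)

/-- A conditionally sub-Gaussian vector with proxy variance `0` vanishes almost surely. -/
lemma IsCondSubGaussian.ae_eq_zero (hF : F ≤ mΩ)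
    (h : IsCondSubGaussian P F w 0 ((0 : ℝ) ^ 2 • (1 : Matrix (Fin n) (Fin n) ℝ))) :
    ∀ᵐ ω ∂P, w ω = 0 := by
  have hcoord (i : Fin n) : ∀ᵐ ω ∂P, w ω i = 0 := by
    have hwi : Integrable (fun ω => w ω i) P := h.integrable.eval i
    have hmean : ∫ ω, w ω i ∂P = 0 := by
      rw [← eval_integral fun j => h.integrable.eval j, h.mean_eq]; rfl
    have hexp : Integrable (fun ω => Real.exp (w ω i)) P := by
      simpa using h.integrable_exp (Pi.single i 1)
    have hle : ∫ ω, Real.exp (w ω i) ∂P ≤ 1 := by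
      have h1 := h.setLIntegral_tiltedExp_le hF (Pi.single i 1)
        (s := Set.univ) MeasurableSet.univ
      simp only [tiltedExp, Measure.restrict_univ, measure_univ] at h1
      rw [integral_eq_lintegral_of_nonneg_ae (ae_of_all _ fun _ => (Real.exp_pos _).le)
        hexp.aestronglyMeasurable]
      refine ENNReal.toReal_le_of_le_ofReal zero_le_one ?_
      simpa using h1
    -- Equality case of `1 + t ≤ exp t`: the mean of `exp (w i)` is at most `1`, which is the mean
    -- of `1 + w i`, so the two agree almost surely and `w i = 0`.
    have hnn : 0 ≤ fun ω => Real.exp (w ω i) - (w ω i + 1) := fun ω =>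
      sub_nonneg.2 (Real.add_one_le_exp _)
    have hi2 : Integrable (fun ω => w ω i + 1) P := hwi.add (integrable_const _)
    have hz : ∫ ω, Real.exp (w ω i) - (w ω i + 1) ∂P = 0 := by
      refine le_antisymm ?_ (integral_nonneg hnn)
      rw [integral_sub hexp hi2, integral_add hwi (integrable_const _), hmean]
      simpa using hle
    have := (integral_eq_zero_iff_of_nonneg hnn (hexp.sub hi2)).1 hz
    filter_upwards [this] with ω hω
    by_contra hne
    exact (Real.add_one_lt_exp hne).ne' (sub_eq_zero.1 hω)
  filter_upwards [ae_all_iff.2 hcoord] with ω hω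
  exact funext hω

end CondSubGaussian

lemma lintegral_prod_tiltedExp_le_one {Ω : Type*} {mΩ : MeasurableSpace Ω} {P : Measure Ω}
    [IsProbabilityMeasure P] {n : ℕ} {σ : ℝ} {F : Filtration ℕ mΩ} {L w : ℕ → Ω → Fin n → ℝ}
    (hL : ∀ k, Measurable[F k] (L k)) (hw : ∀ k, Measurable[F (k + 1)] (w k))
    (h : ∀ k, IsCondSubGaussian P (F k) (w k) 0 (σ ^ 2 • (1 : Matrix (Fin n) (Fin n) ℝ)))
    (T : ℕ) : ∫⁻ ω, ∏ k ∈ Finset.range T, tiltedExp σ (L k ω) (w k ω) ∂P ≤ 1 := by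
  induction T with
  | zero => simp
  | succ T ih =>
    simp_rw [Finset.prod_range_succ]
    refine ((h T).lintegral_mul_tiltedExp_le (F.le T) ((hw T).mono (F.le _) le_rfl) (hL T)
      ?_).trans ih
    refine Finset.measurable_fun_prod _ fun k hk => ?_
    -- The noise `w k` is `F (k + 1)`-measurable and `k + 1 ≤ T`, so the earlier factors are known
    -- at time `T`.
    have hk : k < T := Finset.mem_range.1 hk
    exact @measurable_tiltedExp _ _ _ (F T) _ _
      ((hL k).mono (F.mono hk.le) le_rfl) ((hw k).mono (F.mono hk) le_rfl)

/-! ### Gaussian integrals with a quadratic form. -/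

section Gaussian

variable {ι : Type*} [Fintype ι]

lemma exists_transpose_mul_self_eq {D : Matrix ι ι ℝ} (hD : D.PosDef) :
    ∃ B : Matrix ι ι ℝ, D = Bᵀ * B := by
  classical
  open scoped MatrixOrder in
  have h := hD.posSemidef.nonneg
  obtain ⟨B, hB⟩ := CStarAlgebra.nonneg_iff_eq_star_mul_self.1 h
  exact ⟨B, by simpa [Matrix.star_eq_conjTranspose] using hB⟩

lemma dotProduct_transpose_mul_self_mulVec {κ : Type*} [Fintype κ] (B : Matrix κ ι ℝ)
    (v : ι → ℝ) : v ⬝ᵥ (Bᵀ * B) *ᵥ v = (B *ᵥ v) ⬝ᵥ (B *ᵥ v) := by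
  rw [← Matrix.mulVec_mulVec, Matrix.dotProduct_mulVec, Matrix.vecMul_transpose]

/-- The mass of the unnormalized isotropic Gaussian density. -/
noncomputable def gaussianMass (ι : Type*) [Fintype ι] (c : ℝ) : ℝ≥0∞ :=
  ∫⁻ ψ : ι → ℝ, ENNReal.ofReal (Real.exp (-(c / 2 * (ψ ⬝ᵥ ψ))))

lemma gaussianMass_ne_zero (c : ℝ) : gaussianMass ι c ≠ 0 := by
  unfold gaussianMass
  rw [← pos_iff_ne_zero, lintegral_pos_iff_support]
  · have : (Function.support fun ψ : ι → ℝ =>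
        ENNReal.ofReal (Real.exp (-(c / 2 * (ψ ⬝ᵥ ψ))))) = Set.univ := by
      ext ψ; simp [Real.exp_pos]
    rw [this]
    exact Measure.measure_univ_pos.2 (NeZero.ne _)
  · simp only [dotProduct]; fun_prop

lemma gaussianMass_ne_top {c : ℝ} (hc : 0 < c) : gaussianMass ι c ≠ ∞ := by
  have h : Integrable (fun ψ : ι → ℝ => ∏ i, Real.exp (-(c / 2) * ψ i ^ 2)) :=
    Integrable.fintype_prod fun _ => integrable_exp_neg_mul_sq (half_pos hc)
  have h2 := h.lintegral_lt_top.ne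
  unfold gaussianMass
  convert h2 using 5 with ψ
  rw [← Real.exp_sum, ← Finset.mul_sum]
  simp [dotProduct, sq]

variable [DecidableEq ι]

/-- Substitute `ψ ↦ B ψ` with `D = Bᵀ B`, so that `|det B| = √(det D)`. The mass itself is never
evaluated: it cancels in the mixture argument, which only needs it to be nonzero and finite. -/
lemma lintegral_exp_neg_quadratic {D : Matrix ι ι ℝ} (hD : D.PosDef) (c : ℝ) :
    ∫⁻ ψ : ι → ℝ, ENNReal.ofReal (Real.exp (-(c / 2 * (ψ ⬝ᵥ D *ᵥ ψ)))) =
      ENNReal.ofReal (1 / √D.det) * gaussianMass ι c := by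
  obtain ⟨B, rfl⟩ := exists_transpose_mul_self_eq hD
  have hdet : (Bᵀ * B).det = B.det ^ 2 := by simp [sq]
  have hB : B.det ≠ 0 := by
    have := hD.det_pos
    rw [hdet] at this
    exact fun h => by simp [h] at this
  have hmap := Real.map_matrix_volume_pi_eq_smul_volume_pi hB
  have hm : Measurable fun ψ : ι → ℝ => ENNReal.ofReal (Real.exp (-(c / 2 * (ψ ⬝ᵥ ψ)))) := by
    simp only [dotProduct]; fun_prop
  calc _ = ∫⁻ ψ : ι → ℝ, ENNReal.ofReal (Real.exp (-(c / 2 * (ψ ⬝ᵥ ψ))))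
          ∂(Measure.map (Matrix.toLin' B) volume) := by
        rw [lintegral_map hm (LinearMap.continuous_of_finiteDimensional _).measurable]
        simp only [dotProduct_transpose_mul_self_mulVec, Matrix.toLin'_apply]
    _ = _ := by
        rw [hmap, lintegral_smul_measure, hdet, Real.sqrt_sq_eq_abs, gaussianMass, abs_inv,
          one_div]
        rfl

/-- Completion of the square around the maximizer `c⁻¹ D⁻¹ s`. -/
lemma dotProduct_sub_quadratic_eq {D : Matrix ι ι ℝ} (hD : D.PosDef) {c : ℝ} (hc : 0 < c)
    (s ψ : ι → ℝ) : ψ ⬝ᵥ s - c / 2 * (ψ ⬝ᵥ D *ᵥ ψ) =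
      s ⬝ᵥ D⁻¹ *ᵥ s / (2 * c) +
        -(c / 2 * ((ψ - c⁻¹ • D⁻¹ *ᵥ s) ⬝ᵥ D *ᵥ (ψ - c⁻¹ • D⁻¹ *ᵥ s))) := by
  have hu : IsUnit D.det := hD.det_pos.ne'.isUnit
  have h1 : D *ᵥ D⁻¹ *ᵥ s = s := by
    rw [Matrix.mulVec_mulVec, Matrix.mul_nonsing_inv _ hu, Matrix.one_mulVec]
  have hT : Dᵀ = D := by simpa using hD.isHermitian.eq
  have h2 : (D⁻¹ *ᵥ s) ⬝ᵥ D *ᵥ ψ = ψ ⬝ᵥ s := by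
    rw [Matrix.dotProduct_mulVec, ← Matrix.mulVec_transpose, hT, h1, dotProduct_comm]
  simp only [Matrix.mulVec_sub, Matrix.mulVec_smul, h1, sub_dotProduct, dotProduct_sub,
    smul_dotProduct, dotProduct_smul, h2, smul_eq_mul, dotProduct_comm (D⁻¹ *ᵥ s) s]
  field_simp
  ring

lemma lintegral_exp_dotProduct_sub_quadratic {D : Matrix ι ι ℝ} (hD : D.PosDef) {c : ℝ}
    (hc : 0 < c) (s : ι → ℝ) :
    ∫⁻ ψ : ι → ℝ, ENNReal.ofReal (Real.exp (ψ ⬝ᵥ s - c / 2 * (ψ ⬝ᵥ D *ᵥ ψ))) =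
      ENNReal.ofReal (Real.exp (s ⬝ᵥ D⁻¹ *ᵥ s / (2 * c)) / √D.det) * gaussianMass ι c := by
  simp_rw [dotProduct_sub_quadratic_eq hD hc, Real.exp_add,
    ENNReal.ofReal_mul (Real.exp_pos _).le]
  rw [lintegral_const_mul' _ _ ENNReal.ofReal_ne_top,
    lintegral_sub_right_eq_self
      (fun ψ : ι → ℝ => ENNReal.ofReal (Real.exp (-(c / 2 * (ψ ⬝ᵥ D *ᵥ ψ))))),
    lintegral_exp_neg_quadratic hD, ← mul_assoc, ← ENNReal.ofReal_mul (Real.exp_pos _).le,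
    mul_one_div]

end Gaussian

/-! ### Self-normalized tail bound by the method of mixtures. -/

section Mixture

variable {Ω : Type*} {mΩ : MeasurableSpace Ω} {P : Measure Ω} [IsProbabilityMeasure P]
  {ι κ : Type*} [Fintype ι] [DecidableEq ι] [Fintype κ]

lemma posDef_mul_transpose_add_smul_one (K : Matrix ι κ ℝ) {lam : ℝ} (hlam : 0 < lam) :
    (K * Kᵀ + lam • (1 : Matrix ι ι ℝ)).PosDef := by
  have h := Matrix.posSemidef_self_mul_conjTranspose K
  rw [Matrix.conjTranspose_eq_transpose_of_trivial] at h
  exact Matrix.PosDef.posSemidef_add h (Matrix.PosDef.one.smul hlam)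

/-- The method of mixtures: if the exponential process of the noise `K W` is a supermartingale
in each fixed direction `ψ`, then `K W` satisfies a self-normalized tail bound. -/
theorem measure_lt_selfNormalized_le {K : Ω → Matrix ι κ ℝ} {W : Ω → κ → ℝ}
    (hK : ∀ i k, Measurable fun ω => K ω i k) (hW : ∀ k, Measurable fun ω => W ω k)
    {c lam δ : ℝ} (hc : 0 < c) (hlam : 0 < lam) (hδ : 0 < δ)
    (hexp : ∀ ψ : ι → ℝ, ∫⁻ ω, ENNReal.ofReal (Real.exp
      (((K ω)ᵀ *ᵥ ψ) ⬝ᵥ W ω - c / 2 * (((K ω)ᵀ *ᵥ ψ) ⬝ᵥ ((K ω)ᵀ *ᵥ ψ)))) ∂P ≤ 1) :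
    P {ω | 2 * c * Real.log (√(K ω * (K ω)ᵀ + lam • (1 : Matrix ι ι ℝ)).det /
        (δ * √(lam • (1 : Matrix ι ι ℝ)).det)) <
      (K ω *ᵥ W ω) ⬝ᵥ (K ω * (K ω)ᵀ + lam • (1 : Matrix ι ι ℝ))⁻¹ *ᵥ (K ω *ᵥ W ω)} ≤
      ENNReal.ofReal δ := by
  set D : Ω → Matrix ι ι ℝ := fun ω => K ω * (K ω)ᵀ + lam • (1 : Matrix ι ι ℝ) with hDdef
  have hD (ω : Ω) : (D ω).PosDef := posDef_mul_transpose_add_smul_one _ hlam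
  have hD0 : (lam • (1 : Matrix ι ι ℝ)).PosDef := Matrix.PosDef.one.smul hlam
  have hquad (ω : Ω) (ψ : ι → ℝ) : ψ ⬝ᵥ D ω *ᵥ ψ =
      ((K ω)ᵀ *ᵥ ψ) ⬝ᵥ ((K ω)ᵀ *ᵥ ψ) + ψ ⬝ᵥ (lam • (1 : Matrix ι ι ℝ)) *ᵥ ψ := by
    rw [← dotProduct_transpose_mul_self_mulVec, Matrix.transpose_transpose, hDdef,
      Matrix.add_mulVec, dotProduct_add]
  have hlin (ω : Ω) (ψ : ι → ℝ) : ψ ⬝ᵥ (K ω *ᵥ W ω) = ((K ω)ᵀ *ᵥ ψ) ⬝ᵥ W ω := by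
    rw [Matrix.dotProduct_mulVec, Matrix.mulVec_transpose]
  -- The exponential in direction `ψ` times the Gaussian weight `exp (-c lam ‖ψ‖² / 2)`: the weight
  -- supplies the `lam` part of `D`.
  set g : Ω → (ι → ℝ) → ℝ≥0∞ := fun ω ψ =>
    ENNReal.ofReal (Real.exp (ψ ⬝ᵥ (K ω *ᵥ W ω) - c / 2 * (ψ ⬝ᵥ D ω *ᵥ ψ))) with hg
  have hgm : Measurable (Function.uncurry g) := by
    have hgeq : Function.uncurry g = fun p : Ω × (ι → ℝ) => ENNReal.ofReal (Real.exp
        (((K p.1)ᵀ *ᵥ p.2) ⬝ᵥ W p.1 - c / 2 * (((K p.1)ᵀ *ᵥ p.2) ⬝ᵥ ((K p.1)ᵀ *ᵥ p.2) +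
          p.2 ⬝ᵥ (lam • (1 : Matrix ι ι ℝ)) *ᵥ p.2))) := by
      funext p
      simp only [Function.uncurry, hg, hquad, hlin]
    have hcol (k : κ) : Measurable fun p : Ω × (ι → ℝ) => ((K p.1)ᵀ *ᵥ p.2) k :=
      Finset.measurable_fun_sum _ fun i _ =>
        ((hK i k).comp measurable_fst).mul ((measurable_pi_apply i).comp measurable_snd)
    have hW2 (k : κ) : Measurable fun p : Ω × (ι → ℝ) => W p.1 k := (hW k).comp measurable_fst
    have h1 : Measurable fun p : Ω × (ι → ℝ) => ((K p.1)ᵀ *ᵥ p.2) ⬝ᵥ W p.1 :=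
      Finset.measurable_fun_sum _ fun k _ => (hcol k).mul (hW2 k)
    have h2 : Measurable fun p : Ω × (ι → ℝ) => ((K p.1)ᵀ *ᵥ p.2) ⬝ᵥ ((K p.1)ᵀ *ᵥ p.2) :=
      Finset.measurable_fun_sum _ fun k _ => (hcol k).mul (hcol k)
    have h3 : Measurable fun p : Ω × (ι → ℝ) => p.2 ⬝ᵥ (lam • (1 : Matrix ι ι ℝ)) *ᵥ p.2 := by
      simp only [Matrix.smul_mulVec, Matrix.one_mulVec, dotProduct, Pi.smul_apply]
      fun_prop
    rw [hgeq]
    exact (Real.measurable_exp.comp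
      (h1.sub ((h2.add h3).const_mul (c / 2)))).ennreal_ofReal
  set G := gaussianMass ι c
  set f : Ω → ℝ≥0∞ := fun ω => ENNReal.ofReal
    (Real.exp ((K ω *ᵥ W ω) ⬝ᵥ (D ω)⁻¹ *ᵥ (K ω *ᵥ W ω) / (2 * c)) / √(D ω).det) * G with hf
  have hfg (ω : Ω) : f ω = ∫⁻ ψ, g ω ψ :=
    (lintegral_exp_dotProduct_sub_quadratic (hD ω) hc _).symm
  have hfm : Measurable f := by
    rw [funext hfg]
    exact hgm.lintegral_prod_right
  -- The total mass of the Gaussian weight, which bounds the mean of the mixture `f` by Tonelli.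
  set a : ℝ≥0∞ := ENNReal.ofReal (1 / √(lam • (1 : Matrix ι ι ℝ)).det) * G with ha
  have hint : ∫⁻ ω, f ω ∂P ≤ a := by
    simp_rw [hfg]
    rw [lintegral_lintegral_swap hgm.aemeasurable, ha, ← lintegral_exp_neg_quadratic hD0]
    refine lintegral_mono fun ψ => ?_
    have hsplit (ω : Ω) : g ω ψ =
        ENNReal.ofReal (Real.exp (-(c / 2 * (ψ ⬝ᵥ (lam • (1 : Matrix ι ι ℝ)) *ᵥ ψ)))) *
        ENNReal.ofReal (Real.exp (((K ω)ᵀ *ᵥ ψ) ⬝ᵥ W ω -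
          c / 2 * (((K ω)ᵀ *ᵥ ψ) ⬝ᵥ ((K ω)ᵀ *ᵥ ψ)))) := by
      rw [← ENNReal.ofReal_mul (Real.exp_pos _).le, ← Real.exp_add, hg]
      simp only [hquad, hlin]
      ring_nf
    simp_rw [hsplit]
    rw [lintegral_const_mul' _ _ ENNReal.ofReal_ne_top]
    exact mul_le_of_le_one_right' (hexp ψ)
  have hd0 : 0 < √(lam • (1 : Matrix ι ι ℝ)).det := Real.sqrt_pos.2 hD0.det_pos
  have ha0 : a ≠ 0 := mul_ne_zero (by simpa using hd0) (gaussianMass_ne_zero c)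
  have hat : a ≠ ∞ := ENNReal.mul_ne_top ENNReal.ofReal_ne_top (gaussianMass_ne_top hc)
  -- Exponentiated, the deviation says that `f` reaches `a / δ`, the threshold for Markov's
  -- inequality.
  have hsub : {ω | 2 * c * Real.log (√(D ω).det / (δ * √(lam • (1 : Matrix ι ι ℝ)).det)) <
      (K ω *ᵥ W ω) ⬝ᵥ (D ω)⁻¹ *ᵥ (K ω *ᵥ W ω)} ⊆ {ω | ENNReal.ofReal (1 / δ) * a ≤ f ω} := by
    intro ω hω
    simp only [Set.mem_ofPred_eq] at hω ⊢
    have hdω : 0 < √(D ω).det := Real.sqrt_pos.2 (hD ω).det_pos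
    rw [ha, hf, ← mul_assoc, ← ENNReal.ofReal_mul (by positivity)]
    refine mul_le_mul' (ENNReal.ofReal_le_ofReal ?_) le_rfl
    have h1 : Real.log (√(D ω).det / (δ * √(lam • (1 : Matrix ι ι ℝ)).det)) ≤
        (K ω *ᵥ W ω) ⬝ᵥ (D ω)⁻¹ *ᵥ (K ω *ᵥ W ω) / (2 * c) := by
      rw [le_div_iff₀ (by positivity), mul_comm]
      exact hω.le
    rw [Real.log_le_iff_le_exp (by positivity)] at h1
    rw [le_div_iff₀ hdω]
    refine le_trans (le_of_eq ?_) h1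
    field_simp
  refine (measure_mono hsub).trans ?_
  have hmk := (mul_meas_ge_le_lintegral hfm (ENNReal.ofReal (1 / δ) * a)).trans hint
  rw [mul_assoc, mul_left_comm] at hmk
  have h1 : ENNReal.ofReal (1 / δ) * P {ω | ENNReal.ofReal (1 / δ) * a ≤ f ω} ≤ 1 := by
    refine (ENNReal.mul_le_mul_iff_right ha0 hat).1 ?_
    rwa [mul_one]
  generalize P {ω | ENNReal.ofReal (1 / δ) * a ≤ f ω} = p at h1
  calc p = ENNReal.ofReal δ * (ENNReal.ofReal (1 / δ) * p) := by
        rw [← mul_assoc, ← ENNReal.ofReal_mul hδ.le, mul_one_div_cancel hδ.ne',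
          ENNReal.ofReal_one, one_mul]
    _ ≤ ENNReal.ofReal δ := mul_le_of_le_one_right' h1

end Mixture

/-! ### Error of regularized least squares and the prior norm bound. -/

section Quadratic

variable {ι κ : Type*} [Fintype ι] [Fintype κ]

lemma dotProduct_self_eq_norm_sq {n : Type*} [Fintype n] (v : n → ℝ) :
    v ⬝ᵥ v = ‖WithLp.toLp 2 v‖ ^ 2 := by
  rw [EuclideanSpace.norm_sq_eq]
  simp [dotProduct, sq]

lemma sqrt_quadratic_sub_le {D : Matrix ι ι ℝ} (hD : D.PosDef) (a b : ι → ℝ) :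
    √((a - b) ⬝ᵥ D *ᵥ (a - b)) ≤ √(a ⬝ᵥ D *ᵥ a) + √(b ⬝ᵥ D *ᵥ b) := by
  obtain ⟨B, rfl⟩ := exists_transpose_mul_self_eq hD
  have h (v : ι → ℝ) : √(v ⬝ᵥ (Bᵀ * B) *ᵥ v) = ‖WithLp.toLp 2 (B *ᵥ v)‖ := by
    rw [dotProduct_transpose_mul_self_mulVec, dotProduct_self_eq_norm_sq,
      Real.sqrt_sq (norm_nonneg _)]
  rw [h, h, h, Matrix.mulVec_sub]
  exact norm_sub_le (WithLp.toLp 2 (B *ᵥ a)) (WithLp.toLp 2 (B *ᵥ b))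

lemma quadratic_nonneg {D : Matrix ι ι ℝ} (hD : D.PosSemidef) (v : ι → ℝ) :
    0 ≤ v ⬝ᵥ D *ᵥ v := by
  simpa using hD.dotProduct_mulVec_nonneg v

variable [DecidableEq ι]

lemma quadratic_inv_mulVec {D : Matrix ι ι ℝ} (hD : D.PosDef) (s : ι → ℝ) :
    (D⁻¹ *ᵥ s) ⬝ᵥ D *ᵥ (D⁻¹ *ᵥ s) = s ⬝ᵥ D⁻¹ *ᵥ s := by
  rw [Matrix.mulVec_mulVec, Matrix.mul_nonsing_inv _ hD.det_pos.ne'.isUnit, Matrix.one_mulVec,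
    dotProduct_comm]

lemma quadratic_mul_transpose_add_smul_one (K : Matrix ι κ ℝ) (lam : ℝ) (v : ι → ℝ) :
    v ⬝ᵥ (K * Kᵀ + lam • (1 : Matrix ι ι ℝ)) *ᵥ v =
      (Kᵀ *ᵥ v) ⬝ᵥ (Kᵀ *ᵥ v) + lam * (v ⬝ᵥ v) := by
  rw [← dotProduct_transpose_mul_self_mulVec, Matrix.transpose_transpose, Matrix.add_mulVec,
    dotProduct_add, Matrix.smul_mulVec, Matrix.one_mulVec, dotProduct_smul, smul_eq_mul]

/-- The contribution of the regularization to the error of regularized least squares. -/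
lemma quadratic_inv_le (K : Matrix ι κ ℝ) {lam : ℝ} (hlam : 0 < lam) (θ : ι → ℝ) :
    (lam • θ) ⬝ᵥ (K * Kᵀ + lam • (1 : Matrix ι ι ℝ))⁻¹ *ᵥ (lam • θ) ≤ lam * (θ ⬝ᵥ θ) := by
  have hD := posDef_mul_transpose_add_smul_one K hlam
  set D := K * Kᵀ + lam • (1 : Matrix ι ι ℝ) with hDdef
  set b := D⁻¹ *ᵥ (lam • θ) with hb
  -- From `lam ‖b‖² ≤ bᵀ D b = lam θᵀ b` follows `‖b‖² ≤ θᵀ b`; with `2 θᵀ b ≤ ‖θ‖² + ‖b‖²` this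
  -- yields `θᵀ b ≤ ‖θ‖²`.
  have h1 : lam * (b ⬝ᵥ b) ≤ b ⬝ᵥ D *ᵥ b := by
    rw [hDdef, quadratic_mul_transpose_add_smul_one]
    have := dotProduct_self_eq_norm_sq (Kᵀ *ᵥ b)
    nlinarith [sq_nonneg ‖WithLp.toLp 2 (Kᵀ *ᵥ b)‖]
  have h2 : b ⬝ᵥ D *ᵥ b = (lam • θ) ⬝ᵥ b := quadratic_inv_mulVec hD _
  have h3 : 0 ≤ (θ - b) ⬝ᵥ (θ - b) := by
    rw [dotProduct_self_eq_norm_sq]; positivity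
  simp only [sub_dotProduct, dotProduct_sub, dotProduct_comm b θ] at h3
  rw [smul_dotProduct, smul_eq_mul] at h2 ⊢
  nlinarith

/-- Writing `θ = D⁻¹ D θ`, the term `K Kᵀ θ` cancels; the regularization bias and the noise remain.
-/
lemma rls_error_eq (K : Matrix ι κ ℝ) {lam : ℝ} (hlam : 0 < lam) (θ : ι → ℝ) (W : κ → ℝ) :
    θ - (K * Kᵀ + lam • (1 : Matrix ι ι ℝ))⁻¹ *ᵥ (K *ᵥ (Kᵀ *ᵥ θ + W)) =
      (K * Kᵀ + lam • (1 : Matrix ι ι ℝ))⁻¹ *ᵥ (lam • θ) -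
        (K * Kᵀ + lam • (1 : Matrix ι ι ℝ))⁻¹ *ᵥ (K *ᵥ W) := by
  have hD := posDef_mul_transpose_add_smul_one K hlam
  set D := K * Kᵀ + lam • (1 : Matrix ι ι ℝ) with hDdef
  have hθ : θ = D⁻¹ *ᵥ (D *ᵥ θ) := by
    rw [Matrix.mulVec_mulVec, Matrix.nonsing_inv_mul _ hD.det_pos.ne'.isUnit, Matrix.one_mulVec]
  have hDθ : D *ᵥ θ = K *ᵥ (Kᵀ *ᵥ θ) + lam • θ := by
    rw [hDdef, Matrix.add_mulVec, Matrix.mulVec_mulVec, Matrix.smul_mulVec, Matrix.one_mulVec]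
  conv_lhs => enter [1]; rw [hθ]
  rw [← Matrix.mulVec_sub, ← Matrix.mulVec_sub, hDθ, Matrix.mulVec_add]
  congr 1
  abel

/-- The error of regularized least squares in the norm of the regularized Gram matrix. -/
theorem sqrt_rls_error_le (K : Matrix ι κ ℝ) {lam : ℝ} (hlam : 0 < lam) (θ : ι → ℝ)
    (W : κ → ℝ) {v : ι → ℝ}
    (hv : v = θ - (K * Kᵀ + lam • (1 : Matrix ι ι ℝ))⁻¹ *ᵥ (K *ᵥ (Kᵀ *ᵥ θ + W))) :
    √(v ⬝ᵥ (K * Kᵀ + lam • (1 : Matrix ι ι ℝ)) *ᵥ v) ≤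
      √((K *ᵥ W) ⬝ᵥ (K * Kᵀ + lam • (1 : Matrix ι ι ℝ))⁻¹ *ᵥ (K *ᵥ W)) +
        √lam * ‖WithLp.toLp 2 θ‖ := by
  have hD := posDef_mul_transpose_add_smul_one K hlam
  rw [hv, rls_error_eq K hlam, add_comm (√((K *ᵥ W) ⬝ᵥ _))]
  refine (sqrt_quadratic_sub_le hD _ _).trans ?_
  rw [quadratic_inv_mulVec hD, quadratic_inv_mulVec hD]
  gcongr
  refine Real.sqrt_le_iff.2 ⟨by positivity, ?_⟩
  rw [mul_pow, Real.sq_sqrt hlam.le, ← dotProduct_self_eq_norm_sq]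
  exact quadratic_inv_le K hlam θ

open scoped MatrixOrder Matrix.Norms.L2Operator in
lemma normInvSqrt_nonneg (D : Matrix ι ι ℝ) : 0 ≤ normInvSqrt D :=
  norm_nonneg _

open scoped MatrixOrder Matrix.Norms.L2Operator in
lemma dotProduct_self_le_normInvSqrt {D : Matrix ι ι ℝ} (hD : D.PosDef) (v : ι → ℝ) :
    v ⬝ᵥ v ≤ normInvSqrt D ^ 2 * (v ⬝ᵥ D *ᵥ v) := by
  have hnn : 0 ≤ D := hD.posSemidef.nonneg
  have hQ : CFC.sqrt D * CFC.sqrt D = D := CFC.sqrt_mul_sqrt_self D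
  have hsa : (CFC.sqrt D)ᵀ = CFC.sqrt D := by
    have := (Matrix.nonneg_iff_posSemidef.1 (CFC.sqrt_nonneg D)).isHermitian.eq
    simpa using this
  have hu : IsUnit (CFC.sqrt D).det := by
    have h := hD.det_pos
    rw [← hQ, Matrix.det_mul] at h
    exact isUnit_iff_ne_zero.2 fun h0 => by simp [h0] at h
  have h1 : v ⬝ᵥ D *ᵥ v = ‖WithLp.toLp 2 (CFC.sqrt D *ᵥ v)‖ ^ 2 := by
    rw [← dotProduct_self_eq_norm_sq, ← dotProduct_transpose_mul_self_mulVec, hsa, hQ]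
  have h2 : (CFC.sqrt D)⁻¹ *ᵥ (CFC.sqrt D *ᵥ v) = v := by
    rw [Matrix.mulVec_mulVec, Matrix.nonsing_inv_mul _ hu, Matrix.one_mulVec]
  have h3 := Matrix.l2_opNorm_mulVec (CFC.sqrt D)⁻¹ (WithLp.toLp 2 (CFC.sqrt D *ᵥ v))
  simp only [h2] at h3
  rw [h1, dotProduct_self_eq_norm_sq, ← mul_pow, normInvSqrt]
  gcongr
  exact h3

end Quadratic

/-! ### Kronecker structure and the data condition. -/

variable {nx nu : ℕ}

/-- `D ⊗ I` acts separately on each row of `[A, B]`, so facts about `D` transfer row by row. -/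
lemma kronForm_eq_sum (D : Matrix (RegIdx nx nu) (RegIdx nx nu) ℝ) (v : ParIdx nx nu → ℝ) :
    kronForm D v = ∑ j, (fun i => v (i, j)) ⬝ᵥ D *ᵥ (fun i => v (i, j)) := by
  simp only [kronForm, dotProduct, Matrix.mulVec, Fintype.sum_prod_type, Matrix.kroneckerMap_apply,
    Matrix.one_apply, mul_ite, ite_mul, mul_one, mul_zero, zero_mul, Finset.sum_ite_eq,
    Finset.mem_univ, if_true]
  exact Finset.sum_comm

lemma kronForm_sub (D E : Matrix (RegIdx nx nu) (RegIdx nx nu) ℝ) (v : ParIdx nx nu → ℝ) :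
    kronForm (D - E) v = kronForm D v - kronForm E v := by
  simp only [kronForm_eq_sum, Matrix.sub_mulVec, dotProduct_sub, Finset.sum_sub_distrib]

lemma kronForm_smul (c : ℝ) (D : Matrix (RegIdx nx nu) (RegIdx nx nu) ℝ)
    (v : ParIdx nx nu → ℝ) : kronForm (c • D) v = c * kronForm D v := by
  simp only [kronForm_eq_sum, Matrix.smul_mulVec, dotProduct_smul, smul_eq_mul, Finset.mul_sum]

lemma kronForm_nonneg {D : Matrix (RegIdx nx nu) (RegIdx nx nu) ℝ} (hD : D.PosSemidef)
    (v : ParIdx nx nu → ℝ) : 0 ≤ kronForm D v := by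
  rw [kronForm_eq_sum]
  exact Finset.sum_nonneg fun j _ => quadratic_nonneg hD _

lemma norm_le_normInvSqrt_of_kronForm_le_one {D : Matrix (RegIdx nx nu) (RegIdx nx nu) ℝ}
    (hD : D.PosDef) {v : ParIdx nx nu → ℝ} (hv : kronForm D v ≤ 1) :
    ‖WithLp.toLp 2 v‖ ≤ normInvSqrt D := by
  have h0 := normInvSqrt_nonneg D
  refine abs_le_of_sq_le_sq' ?_ h0 |>.2
  rw [← dotProduct_self_eq_norm_sq]
  calc v ⬝ᵥ v = ∑ j, (fun i => v (i, j)) ⬝ᵥ (fun i => v (i, j)) := by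
        simp only [dotProduct, Fintype.sum_prod_type]
        exact Finset.sum_comm
    _ ≤ normInvSqrt D ^ 2 * kronForm D v := by
        rw [kronForm_eq_sum, Finset.mul_sum]
        exact Finset.sum_le_sum fun j _ => dotProduct_self_le_normInvSqrt hD _
    _ ≤ normInvSqrt D ^ 2 := mul_le_of_le_one_right (sq_nonneg _) hv

lemma norm_le_thetaBar {θ₀ θ : ParIdx nx nu → ℝ}
    {D₀ : Matrix (RegIdx nx nu) (RegIdx nx nu) ℝ} (hD₀ : D₀.PosDef) (hθ : θ ∈ priorSet θ₀ D₀) :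
    ‖WithLp.toLp 2 θ‖ ≤ thetaBar θ₀ D₀ := by
  have h := norm_le_normInvSqrt_of_kronForm_le_one hD₀ (show kronForm D₀ (θ₀ - θ) ≤ 1 from hθ)
  have h2 := norm_sub_le (WithLp.toLp 2 θ₀) (WithLp.toLp 2 (θ₀ - θ))
  rw [← WithLp.toLp_sub, sub_sub_cancel] at h2
  exact h2.trans (add_le_add_right h _)

lemma regExcitation_eq_mul_transpose {T : ℕ} (lam : ℝ) (Φ : Matrix (RegIdx nx nu) (Fin T) ℝ) :
    regExcitation lam Φ =
      (Φ ⊗ₖ (1 : Matrix (Fin nx) (Fin nx) ℝ)) * (Φ ⊗ₖ (1 : Matrix (Fin nx) (Fin nx) ℝ))ᵀ +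
        lam • 1 := by
  rw [regExcitation, ← Matrix.kroneckerMap_transpose, Matrix.transpose_one,
    ← Matrix.mul_kronecker_mul, Matrix.mul_one]

/-- Links the Gram matrix of the estimator to the smaller matrix in the data condition. -/
lemma regExcitation_eq_kronecker {T : ℕ} (lam : ℝ) (Φ : Matrix (RegIdx nx nu) (Fin T) ℝ) :
    regExcitation (nx := nx) lam Φ =
      (Φ * Φᵀ + lam • (1 : Matrix (RegIdx nx nu) (RegIdx nx nu) ℝ)) ⊗ₖ
        (1 : Matrix (Fin nx) (Fin nx) ℝ) := by
  rw [regExcitation, Matrix.add_kronecker, Matrix.smul_kronecker, Matrix.one_kronecker_one]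

lemma kronecker_one_transpose_mulVec {T : ℕ} (Φ : Matrix (RegIdx nx nu) (Fin T) ℝ)
    (v : ParIdx nx nu → ℝ) (k : Fin T) (j : Fin nx) :
    ((Φ ⊗ₖ (1 : Matrix (Fin nx) (Fin nx) ℝ))ᵀ *ᵥ v) (k, j) = ∑ i, Φ i k * v (i, j) := by
  simp only [Matrix.mulVec, dotProduct, Fintype.sum_prod_type, Matrix.transpose_apply,
    Matrix.kroneckerMap_apply, Matrix.one_apply, mul_ite, ite_mul, mul_one, mul_zero, zero_mul,
    Finset.sum_ite_eq', Finset.mem_univ, if_true]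

lemma stackedStates_eq {A : Matrix (Fin nx) (Fin nx) ℝ} {B : Matrix (Fin nx) (Fin nu) ℝ}
    {x w : ℕ → Fin nx → ℝ} {u : ℕ → Fin nu → ℝ}
    (hx : ∀ k, x (k + 1) = A *ᵥ x k + B *ᵥ u k + w k) (T : ℕ) :
    stackedStates T x =
      (dataMatrix T x u ⊗ₖ (1 : Matrix (Fin nx) (Fin nx) ℝ))ᵀ *ᵥ paramVec A B +
        fun p => w p.1 p.2 := by
  funext ⟨k, j⟩
  rw [Pi.add_apply, kronecker_one_transpose_mulVec]
  simp only [stackedStates, hx, Pi.add_apply, dataMatrix, regressor, paramVec, Matrix.of_apply,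
    Fintype.sum_sum_type, Sum.elim_inl, Sum.elim_inr, Matrix.vec, Matrix.fromCols_apply_inl,
    Matrix.fromCols_apply_inr, Matrix.mulVec, dotProduct, mul_comm]

lemma kronForm_le_one_of_dataCondition {T : ℕ} {σ lam δ θbar r : ℝ} (hlam : 0 < lam)
    {Ddes : Matrix (RegIdx nx nu) (RegIdx nx nu) ℝ} {Φ : Matrix (RegIdx nx nu) (Fin T) ℝ}
    (h : DataCondition σ lam δ θbar Ddes Φ) {v : ParIdx nx nu → ℝ}
    (hr : r ≤ √(radius σ lam δ (regExcitation lam Φ)) + √lam * θbar)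
    (hv : √(v ⬝ᵥ regExcitation lam Φ *ᵥ v) ≤ r) : kronForm Ddes v ≤ 1 := by
  set ρ := √(radius σ lam δ (regExcitation lam Φ)) + √lam * θbar with hρ
  have hle := kronForm_nonneg h v
  rw [kronForm_sub, kronForm_smul, ← hρ] at hle
  have hM : kronForm (Φ * Φᵀ + lam • (1 : Matrix (RegIdx nx nu) (RegIdx nx nu) ℝ)) v =
      v ⬝ᵥ regExcitation lam Φ *ᵥ v := by
    rw [regExcitation_eq_kronecker]; rfl
  have hpd : (regExcitation lam Φ : Matrix (ParIdx nx nu) (ParIdx nx nu) ℝ).PosDef := by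
    rw [regExcitation_eq_mul_transpose]; exact posDef_mul_transpose_add_smul_one _ hlam
  have hρ0 : 0 ≤ ρ := (Real.sqrt_nonneg _).trans (hv.trans hr)
  have hsq : v ⬝ᵥ regExcitation lam Φ *ᵥ v ≤ ρ ^ 2 :=
    (Real.sqrt_le_left hρ0).1 (hv.trans hr)
  -- If `ρ = 0` one cannot divide by `ρ ^ 2`, but then positive definiteness forces `v = 0`.
  rcases hρ0.eq_or_lt with h0 | hpos
  · have hv0 : v = 0 := by
      by_contra hne
      have := hpd.dotProduct_mulVec_pos hne
      rw [← h0] at hsq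
      simp only [star_trivial] at this
      linarith [zero_pow (M₀ := ℝ) two_ne_zero]
    simp [hv0, kronForm]
  · rw [hM] at hle
    have : ρ ^ 2 * kronForm Ddes v ≤ ρ ^ 2 * 1 := by linarith
    exact le_of_mul_le_mul_left this (by positivity)

/-! ### High-probability bound for the noise of the system. -/

/-- Subadditivity suffices, so `s` need not be measurable. -/
lemma one_sub_le_measureReal_of_measure_compl_le {Ω : Type*} {mΩ : MeasurableSpace Ω}
    {P : Measure Ω} [IsProbabilityMeasure P] {s : Set Ω} {δ : ℝ} (hδ : 0 ≤ δ)
    (h : P sᶜ ≤ ENNReal.ofReal δ) : 1 - δ ≤ P.real s := by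
  have h1 : P.real sᶜ ≤ δ := ENNReal.toReal_le_of_le_ofReal hδ h
  have h2 := measureReal_union_le (μ := P) s sᶜ
  rw [Set.union_compl_self, probReal_univ] at h2
  linarith

lemma sqrt_le_sqrt_radius {nx nu : ℕ} {σ lam δ q : ℝ} (hlam : 0 < lam) (hδ : 0 < δ)
    {D : Matrix (ParIdx nx nu) (ParIdx nx nu) ℝ} (hD : D.PosDef) (hq0 : 0 ≤ q)
    (hq : q ≤ 2 * σ ^ 2 * Real.log (√D.det /
      (δ * √(lam • (1 : Matrix (ParIdx nx nu) (ParIdx nx nu) ℝ)).det))) :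
    √q ≤ √(radius σ lam δ D) := by
  refine Real.sqrt_le_sqrt (hq.trans ?_)
  have hd : 0 < √(lam • (1 : Matrix (ParIdx nx nu) (ParIdx nx nu) ℝ)).det :=
    Real.sqrt_pos.2 (Matrix.PosDef.one.smul hlam).det_pos
  have hdD : 0 < √D.det := Real.sqrt_pos.2 hD.det_pos
  have hlog5 : 0 ≤ Real.log ((5 : ℝ) ^ nx) := Real.log_nonneg (one_le_pow₀ (by norm_num))
  rw [radius, mul_div_assoc, Real.log_mul (by positivity) (by positivity)]
  -- The radius has `8` in place of `2` and an extra `5 ^ nx`. Enlarging the constant is harmless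
  -- because `σ ^ 2` times the logarithm is nonnegative, being bounded below by `q / 2`.
  have h0 := hq0.trans hq
  have h1 : 0 ≤ σ ^ 2 * Real.log ((5 : ℝ) ^ nx) := by positivity
  nlinarith

/-- The self-normalized bound for the noise of the linear system. -/
theorem one_sub_le_measureReal_noise_le {Ω : Type*} {mΩ : MeasurableSpace Ω} {P : Measure Ω}
    [IsProbabilityMeasure P] {nx nu : ℕ} {x w : ℕ → Ω → Fin nx → ℝ} {u : ℕ → Ω → Fin nu → ℝ}
    {F : Filtration ℕ mΩ}
    (hφ : ∀ k, Measurable[F k] fun ω => regressor (fun j => x j ω) (fun j => u j ω) k)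
    (hw : ∀ k, Measurable[F (k + 1)] (w k)) {σ : ℝ}
    (hsub : ∀ k, IsCondSubGaussian P (F k) (w k) 0 (σ ^ 2 • (1 : Matrix (Fin nx) (Fin nx) ℝ)))
    {lam δ : ℝ} (hlam : 0 < lam) (hδ : 0 < δ) (T : ℕ)
    {K : Ω → Matrix (ParIdx nx nu) (Fin T × Fin nx) ℝ}
    (hK : ∀ ω, K ω = dataMatrix T (fun j => x j ω) (fun j => u j ω) ⊗ₖ 1)
    {W : Ω → Fin T × Fin nx → ℝ} (hW : ∀ ω, W ω = fun p => w p.1 ω p.2) :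
    1 - δ ≤ P.real {ω | √((K ω *ᵥ W ω) ⬝ᵥ
      (K ω * (K ω)ᵀ + lam • (1 : Matrix (ParIdx nx nu) (ParIdx nx nu) ℝ))⁻¹ *ᵥ (K ω *ᵥ W ω)) ≤
        √(radius σ lam δ (K ω * (K ω)ᵀ + lam • 1))} := by
  refine one_sub_le_measureReal_of_measure_compl_le hδ.le ?_
  have hφm (k : ℕ) (i : RegIdx nx nu) :
      Measurable[F k] fun ω => regressor (fun j => x j ω) (fun j => u j ω) k i :=
    (measurable_pi_apply i).comp (hφ k)
  have hwm (k : ℕ) : Measurable (w k) := (hw k).mono (F.le _) le_rfl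
  -- The mixture needs `c = σ ^ 2 > 0`; for `σ = 0` the noise vanishes almost surely.
  rcases eq_or_ne σ 0 with rfl | hσ
  · have hzero : ∀ᵐ ω ∂P, ∀ k, w k ω = 0 :=
      ae_all_iff.2 fun k => (hsub k).ae_eq_zero (F.le k)
    refine (le_of_eq ?_).trans zero_le
    refine measure_mono_null ?_ (ae_iff.1 hzero)
    intro ω hω
    contrapose! hω
    have hW0 : W ω = 0 := by
      rw [hW]
      funext p
      have : ∀ k, w k ω = 0 := by simpa using hω
      simp [this]
    simp [hW0]
  · have hKm (p : ParIdx nx nu) (k : Fin T × Fin nx) : Measurable fun ω => K ω p k := by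
      simp only [hK, Matrix.kroneckerMap_apply, dataMatrix, Matrix.of_apply]
      exact ((hφm k.1 p.1).mono (F.le _) le_rfl).mul_const _
    have hWm (k : Fin T × Fin nx) : Measurable fun ω => W ω k := by
      simp only [hW]
      exact (measurable_pi_apply k.2).comp (hwm k.1)
    have hexp (ψ : ParIdx nx nu → ℝ) : ∫⁻ ω, ENNReal.ofReal (Real.exp
        (((K ω)ᵀ *ᵥ ψ) ⬝ᵥ W ω - σ ^ 2 / 2 * (((K ω)ᵀ *ᵥ ψ) ⬝ᵥ ((K ω)ᵀ *ᵥ ψ)))) ∂P ≤ 1 := by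
      -- The `k`-th block of `Kᵀ ψ` depends only on `φ_k`, hence is known before `w k` acts, and the
      -- exponential factorizes over time.
      set L : ℕ → Ω → Fin nx → ℝ := fun k ω j =>
        ∑ i, regressor (fun j => x j ω) (fun j => u j ω) k i * ψ (i, j) with hL
      have hLm (k : ℕ) : Measurable[F k] (L k) :=
        @measurable_pi_lambda _ _ _ (F k) _ _ fun j =>
          Finset.measurable_fun_sum _ fun i _ => (hφm k i).mul_const _
      refine (le_of_eq (lintegral_congr fun ω => ?_)).trans
        (lintegral_prod_tiltedExp_le_one hLm hw hsub T)
      have hcol (k : Fin T) (j : Fin nx) : ((K ω)ᵀ *ᵥ ψ) (k, j) = L k ω j := by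
        rw [hK, kronecker_one_transpose_mulVec]
        rfl
      simp only [tiltedExp]
      rw [← ENNReal.ofReal_prod_of_nonneg fun _ _ => (Real.exp_pos _).le, ← Real.exp_sum,
        Finset.sum_sub_distrib, ← Finset.mul_sum, Finset.sum_range, Finset.sum_range]
      simp only [dotProduct, Fintype.sum_prod_type, hcol, hW]
    refine (measure_mono ?_).trans
      (measure_lt_selfNormalized_le hKm hWm (sq_pos_of_ne_zero hσ) hlam hδ hexp)
    intro ω hω
    contrapose! hω
    have hD := posDef_mul_transpose_add_smul_one (K ω) hlam
    simp only [Set.mem_compl_iff, Set.mem_ofPred_eq, not_not, not_lt] at hω ⊢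
    exact sqrt_le_sqrt_radius hlam hδ hD (quadratic_nonneg hD.inv.posSemidef _) hω

end TargetedExploration

theorem theorem2 {Ω : Type*} {mΩ : MeasurableSpace Ω} (P : Measure Ω) [IsProbabilityMeasure P]
    (nx nu : ℕ)
    -- the system `x_{k+1} = A x_k + B u_k + w_k`, `x_0 = 0`
    (A : Matrix (Fin nx) (Fin nx) ℝ) (B : Matrix (Fin nx) (Fin nu) ℝ)
    (x w : ℕ → Ω → Fin nx → ℝ) (u : ℕ → Ω → Fin nu → ℝ)
    (hx_zero : ∀ ω, x 0 ω = 0)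
    (hx_succ : ∀ k ω, x (k + 1) ω = A *ᵥ x k ω + B *ᵥ u k ω + w k ω)
    -- the filtration: `F k` is the information before `w_k` acts (usually written `F_{k-1}`)
    (F : Filtration ℕ mΩ)
    (hφ : ∀ k, Measurable[F k]
      fun ω => TargetedExploration.regressor (fun j => x j ω) (fun j => u j ω) k)
    (hw : ∀ k, Measurable[F (k + 1)] (w k))
    -- the disturbance is conditionally sub-Gaussian with mean `0` and proxy variance `σ² I`
    (σ : ℝ)
    (hsub : ∀ k, TargetedExploration.IsCondSubGaussian P (F k) (w k) 0
      (σ ^ 2 • (1 : Matrix (Fin nx) (Fin nx) ℝ)))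
    -- the true parameter lies in the prior ellipsoid
    (θ₀ : TargetedExploration.ParIdx nx nu → ℝ)
    (D₀ : Matrix (TargetedExploration.RegIdx nx nu) (TargetedExploration.RegIdx nx nu) ℝ)
    (hD₀ : D₀.PosDef)
    (hθ : TargetedExploration.paramVec A B ∈ TargetedExploration.priorSet θ₀ D₀)
    -- the desired accuracy, the regularization constant, the confidence level and the horizon
    (Ddes : Matrix (TargetedExploration.RegIdx nx nu) (TargetedExploration.RegIdx nx nu) ℝ)
    (hDdes : Ddes.PosDef)
    (lam : ℝ) (hlam : 0 < lam) (δ : ℝ) (hδ : 0 < δ) (T : ℕ) :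
    -- with probability at least `1 - δ`: if the data satisfy the condition, the goal is met
    (1 - δ ≤ P.real {ω |
        TargetedExploration.DataCondition σ lam δ (TargetedExploration.thetaBar θ₀ D₀) Ddes
          (TargetedExploration.dataMatrix T (fun j => x j ω) (fun j => u j ω)) →
        TargetedExploration.kronForm Ddes (TargetedExploration.paramVec A B -
          TargetedExploration.rlsEstimate lam T (fun j => x j ω) (fun j => u j ω)) ≤ 1}) ∧
    -- in particular, if the condition holds almost surely, the goal is met with that probability
    ((∀ᵐ ω ∂P, TargetedExploration.DataCondition σ lam δ
        (TargetedExploration.thetaBar θ₀ D₀) Ddes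
        (TargetedExploration.dataMatrix T (fun j => x j ω) (fun j => u j ω))) →
      1 - δ ≤ P.real {ω |
        TargetedExploration.kronForm Ddes (TargetedExploration.paramVec A B -
          TargetedExploration.rlsEstimate lam T (fun j => x j ω) (fun j => u j ω)) ≤ 1}) := by
  open TargetedExploration in
  set K : Ω → Matrix (ParIdx nx nu) (Fin T × Fin nx) ℝ := fun ω =>
    dataMatrix T (fun j => x j ω) (fun j => u j ω) ⊗ₖ 1
  set W : Ω → Fin T × Fin nx → ℝ := fun ω p => w p.1 ω p.2
  have hmain : 1 - δ ≤ P.real {ω |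
      DataCondition σ lam δ (thetaBar θ₀ D₀) Ddes
        (dataMatrix T (fun j => x j ω) (fun j => u j ω)) →
      kronForm Ddes (paramVec A B - rlsEstimate lam T (fun j => x j ω) (fun j => u j ω)) ≤ 1} := by
    -- The noise event does not involve the data condition; on it the implication is purely
    -- algebraic.
    refine (one_sub_le_measureReal_noise_le hφ hw hsub hlam hδ T (K := K) (W := W)
      (fun _ => rfl) (fun _ => rfl)).trans (measureReal_mono fun ω hω hcond => ?_)
    have hexc : K ω * (K ω)ᵀ + lam • 1 =
        regExcitation lam (dataMatrix T (fun j => x j ω) (fun j => u j ω)) :=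
      (regExcitation_eq_mul_transpose _ _).symm
    have herr := sqrt_rls_error_le (K ω) hlam (paramVec A B) (W ω) rfl
    rw [hexc] at herr
    rw [Set.mem_ofPred_eq, hexc] at hω
    rw [rlsEstimate, stackedStates_eq (fun k => hx_succ k ω)]
    exact kronForm_le_one_of_dataCondition hlam hcond (add_le_add hω
      (mul_le_mul_of_nonneg_left (norm_le_thetaBar hD₀ hθ) (Real.sqrt_nonneg lam))) herr
  refine ⟨hmain, fun hcond => hmain.trans ?_⟩
  refine ENNReal.toReal_mono (measure_ne_top _ _) (measure_mono_ae ?_)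
  filter_upwards [hcond] with ω hω himp using himp hω
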